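/- Let $G$ be a finite connected plane graph (loops and parallel edges allowed) with symmetric non-negative, possibly infinite, edge lengths, with two designated faces $v_{int}$ and $v_{ext}$, where $v_{ext}$ is treated as the infinite face, and with a set $X$ of faces called terminals. (The case of interest is an annulus graph, i.e. the part of a plane graph between two nested cycles, where $v_{int}$ is the face bounded by the inner cycle and $v_{ext}$ the face bounded by the outer one.) Each edge consists of two oppositely directed darts. A cycle encloses a face if it separates that face from $v_{ext}$, i.e. if every walk in the dual graph from that face to $v_{ext}$ crosses an edge of the cycle. Let $f$ be a vertex of $G$, let $T^*$ be a shortest-path tree of $G$ rooted at $f$, and let $T$ be the interdigitating tree of $T^*$, i.e. the spanning tree of the dual of $G$ formed by the duals of the edges of $G$ that are not in $T^*$. Root $T$ at $v_{ext}$. Let $\lambda_T$ be the orientation of the edges of $G$ not in $T^*$ that corresponds to the rootwise orientation of $T$: for such an edge $e$, $\lambda_T(e)$ is the dart of $e$ that has the child endpoint of $e$ in $T$ as its left face and the parent endpoint as its right face. An edge of $T$ is an ancestor edge of a face $t$ if it lies on the path in $T$ from $t$ to $v_{ext}$. A dart is red if it is $\lambda_T(e)$ for an edge $e$ that is an ancestor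 edge of some terminal. Let $C$ be a simple oriented cycle in $G$ that is counterclockwise (its interior lies to its left), separates $v_{int}$ from $v_{ext}$, passes through $f$, and agrees with $\lambda_T$ (whenever $C$ uses an edge $e$ not in $T^*$, it uses the dart $\lambda_T(e)$). Then $C$ encloses a terminal if and only if $C$ uses a red dart. -/

import Mathlib

/-- `IsWalk src tgt a p b`: the list of darts `p` is a walk from `a` to `b`, where each dart `d`
is traversed from `src d` to `tgt d`. It is used with (tail, head) for walks in an embedded graph,
and with (left face, right face) for walks in its dual. -/
def IsWalk {D N : Type*} (src tgt : D → N) : N → List D → N → Prop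
  | a, [], b => a = b
  | a, d :: p, b => src d = a ∧ IsWalk src tgt (tgt d) p b

/-- A walk that visits no node twice. -/
def IsPath {D N : Type*} (src tgt : D → N) (a : N) (p : List D) (b : N) : Prop :=
  IsWalk src tgt a p b ∧ (a :: p.map tgt).Nodup

/-- An undirected multigraph (loops and parallel edges allowed) with a combinatorial embedding in
an oriented surface. `D` is the set of darts, `rev` exchanges the two darts of an edge, and `rot`
sends a dart to the next dart with the same tail in counterclockwise order. -/
structure EmbeddedGraph (D : Type*) where
  rev : D → D
  rev_rev : ∀ d, rev (rev d) = d
  rev_ne : ∀ d, rev d ≠ d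
  rot : Equiv.Perm D

namespace EmbeddedGraph

variable {D : Type*} (G : EmbeddedGraph D)

/-- The next dart along the boundary of the face on the left of a dart: reverse the dart, then
take the clockwise next dart at its head. -/
def faceNext : Equiv.Perm D :=
  (Function.Involutive.toPerm G.rev G.rev_rev).trans G.rot.symm

/-- The vertices are the cycles of the rotation. -/
def Vertex : Type _ := Quotient (Equiv.Perm.SameCycle.setoid G.rot)

/-- The faces (the vertices of the dual graph) are the cycles of `faceNext`. -/
def Face : Type _ := Quotient (Equiv.Perm.SameCycle.setoid G.faceNext)

def tail (d : D) : G.Vertex := Quotient.mk (Equiv.Perm.SameCycle.setoid G.rot) d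

def head (d : D) : G.Vertex := G.tail (G.rev d)

def leftFace (d : D) : G.Face := Quotient.mk (Equiv.Perm.SameCycle.setoid G.faceNext) d

def rightFace (d : D) : G.Face := G.leftFace (G.rev d)

/-- A connected embedded graph is plane if Euler's formula `V - E + F = 2` holds; the equation is
multiplied by two, since there are two darts to an edge. -/
def IsPlane : Prop :=
  (∀ u v : G.Vertex, ∃ p, IsWalk G.tail G.head u p v) ∧
    2 * (Nat.card G.Vertex + Nat.card G.Face) = Nat.card D + 4

/-- A simple oriented cycle, as the list of its darts. The last clause rules out the closed walk
that runs along one edge and back. -/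
def IsSimpleCycle (C : List D) : Prop :=
  C ≠ [] ∧ (∃ v, IsWalk G.tail G.head v C v) ∧ (C.map G.tail).Nodup ∧ ∀ d ∈ C, G.rev d ∉ C

/-- A spanning tree, as the set of the darts of its edges. -/
def IsSpanningTree (T : Set D) : Prop :=
  (∀ d ∈ T, G.rev d ∈ T) ∧
    (∀ u v : G.Vertex, ∃ p, IsWalk G.tail G.head u p v ∧ ∀ d ∈ p, d ∈ T) ∧
    ∀ C, G.IsSimpleCycle C → ∃ d ∈ C, d ∉ T

/-- A spanning tree whose paths from `r` are shortest for the edge lengths `w`. -/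
def IsShortestPathTree (w : D → ENNReal) (r : G.Vertex) (T : Set D) : Prop :=
  G.IsSpanningTree T ∧
    ∀ (v : G.Vertex) (p q : List D), IsPath G.tail G.head r p v → (∀ d ∈ p, d ∈ T) →
      IsWalk G.tail G.head r q v → (p.map w).sum ≤ (q.map w).sum

/-- `C` separates two faces: every walk in the dual from one to the other crosses an edge
of `C`. -/
def Separates (C : List D) (a b : G.Face) : Prop :=
  ∀ p, IsWalk G.leftFace G.rightFace a p b → ∃ d ∈ p, d ∈ C ∨ G.rev d ∈ C

/-- `C` encloses the face `a`, where `infty` is the infinite face. -/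
def Encloses (infty : G.Face) (C : List D) (a : G.Face) : Prop := G.Separates C a infty

/-- An oriented cycle is counterclockwise if its interior lies to its left. -/
def IsCounterclockwise (infty : G.Face) (C : List D) : Prop :=
  ∀ d ∈ C, G.Encloses infty C (G.leftFace d)

/-- `p` is the path from the face `a` to the root face `r` in the interdigitating tree of `T`,
the subgraph of the dual formed by the edges that are not in `T`. -/
def IsRootPath (T : Set D) (r a : G.Face) (p : List D) : Prop :=
  IsPath G.leftFace G.rightFace a p r ∧ ∀ d ∈ p, d ∉ T

/-- The orientation of the edges outside `T` that corresponds to the rootwise orientation of the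
interdigitating tree with root `r`, as the set of the chosen darts: the dual dart of `d`, from the
left face of `d` to its right face, is the first dart of a path of that tree to the root. -/
def treeOrientation (T : Set D) (r : G.Face) : Set D :=
  {d | ∃ p, G.IsRootPath T r (G.leftFace d) (d :: p)}

/-- The oriented cycle `C` agrees with the orientation `treeOrientation T r`, whose domain is the
set of the edges outside `T`. -/
def AgreesWithTree (T : Set D) (r : G.Face) (C : List D) : Prop :=
  ∀ d ∈ C, d ∉ T → d ∈ G.treeOrientation T r

/-- The edge of the dart `d` is an ancestor of the face `a` in the interdigitating tree of `T`
with root `r`: it lies on the path from `a` to `r`. -/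
def IsAncestorEdge (T : Set D) (r a : G.Face) (d : D) : Prop :=
  ∃ p, G.IsRootPath T r a p ∧ (d ∈ p ∨ G.rev d ∈ p)

/-- The red darts: the darts of `treeOrientation T r` whose edge is an ancestor of a terminal. -/
def redDarts (T : Set D) (r : G.Face) (X : Set G.Face) : Set D :=
  {d | d ∈ G.treeOrientation T r ∧ ∃ t ∈ X, G.IsAncestorEdge T r t d}

end EmbeddedGraph

/-! The edges outside a spanning tree form a spanning tree of the dual. They connect the dual, since
otherwise the edges bounding a component would lie in the tree and contain a cycle
(`IsSpanningTree.reachableIn_compl`). By Euler's formula, dropping one of them disconnects the dual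
(`IsSpanningTree.not_reachableIn_diff`). Hence no edge is oriented both ways by root paths, and a
root path can meet an agreeing cycle `C` only in darts of `C`, that is, from left to right.

If `C` encloses a terminal, the terminal's root path must cross `C`, and it does so in a red dart.
Conversely, a red dart of `C` lies on the root path of some terminal. The first dart of that path on
`C` has an enclosed left face, and no edge before it lies on `C`, so the terminal is enclosed
(`encloses_of_mem_isRootPath`). -/

section Walks

/-! ### Walks and reachability in multigraphs -/

variable {D N : Type*} {src tgt : D → N}

theorem IsWalk.append {a b c : N} {p q : List D} (hp : IsWalk src tgt a p b)
    (hq : IsWalk src tgt b q c) : IsWalk src tgt a (p ++ q) c := by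
  induction p generalizing a with
  | nil => cases hp; exact hq
  | cons d p ih => exact ⟨hp.1, ih hp.2⟩

theorem IsWalk.src_mem {a b : N} {p : List D} (hp : IsWalk src tgt a p b) {d : D} (hd : d ∈ p) :
    src d ∈ a :: p.map tgt := by
  induction p generalizing a with
  | nil => simp at hd
  | cons e p ih =>
    rcases List.mem_cons.1 hd with rfl | hd
    · simp [hp.1]
    · exact List.mem_cons_of_mem _ (ih hp.2 hd)

theorem IsWalk.exists_suffix {a b c : N} {p : List D} (hp : IsWalk src tgt a p b)
    (hc : c ∈ a :: p.map tgt) :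
    ∃ q, q ⊆ p ∧ (c :: q.map tgt) <:+ (a :: p.map tgt) ∧ IsWalk src tgt c q b := by
  induction p generalizing a with
  | nil =>
    obtain rfl : c = a := by simpa using hc
    exact ⟨[], List.Subset.refl _, List.suffix_refl _, hp⟩
  | cons d p ih =>
    rcases List.mem_cons.1 hc with rfl | hc
    · exact ⟨d :: p, List.Subset.refl _, List.suffix_refl _, hp⟩
    · obtain ⟨q, hqp, hq, hw⟩ := ih hp.2 hc
      exact ⟨q, List.subset_cons_of_subset d hqp, hq.trans (List.suffix_cons a _), hw⟩

/-- Whenever the shortened tail returns to the starting node, the loop is cut off by passing to a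
suffix. -/
theorem IsWalk.exists_isPath {a b : N} {p : List D} (hp : IsWalk src tgt a p b) :
    ∃ q, q ⊆ p ∧ IsPath src tgt a q b := by
  induction p generalizing a with
  | nil => exact ⟨[], List.Subset.refl _, hp, by simp⟩
  | cons d p ih =>
    obtain ⟨q, hqp, hw, hn⟩ := ih hp.2
    by_cases ha : a ∈ tgt d :: q.map tgt
    · obtain ⟨q', hq', hs, hw'⟩ := hw.exists_suffix ha
      exact ⟨q', fun x hx => List.mem_cons_of_mem d (hqp (hq' hx)), hw', hn.sublist hs.sublist⟩
    · exact ⟨d :: q, List.cons_subset_cons d hqp, ⟨hp.1, hw⟩, List.nodup_cons.2 ⟨ha, hn⟩⟩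

/-- `b` can be reached from `a` by a walk with darts in `A`. -/
def ReachableIn (src tgt : D → N) (A : Set D) (a b : N) : Prop :=
  ∃ p, IsWalk src tgt a p b ∧ ∀ d ∈ p, d ∈ A

theorem ReachableIn.refl (A : Set D) (a : N) : ReachableIn src tgt A a a :=
  ⟨[], rfl, by simp⟩

theorem ReachableIn.trans {A : Set D} {a b c : N} (h₁ : ReachableIn src tgt A a b)
    (h₂ : ReachableIn src tgt A b c) : ReachableIn src tgt A a c := by
  obtain ⟨p, hp, hpA⟩ := h₁
  obtain ⟨q, hq, hqA⟩ := h₂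
  refine ⟨p ++ q, hp.append hq, fun d hd => ?_⟩
  exact (List.mem_append.1 hd).elim (hpA d) (hqA d)

theorem ReachableIn.of_mem {A : Set D} {d : D} (hd : d ∈ A) :
    ReachableIn src tgt A (src d) (tgt d) :=
  ⟨[d], ⟨rfl, rfl⟩, by simpa using hd⟩

/-- A relation that is reflexive and transitive and contains the steps along the darts in `A`
contains reachability in `A`. -/
theorem ReachableIn.lift {A : Set D} {r : N → N → Prop} (hr : ∀ a, r a a)
    (ht : ∀ a b c, r a b → r b c → r a c) (hA : ∀ d ∈ A, r (src d) (tgt d)) {a b : N}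
    (h : ReachableIn src tgt A a b) : r a b := by
  obtain ⟨p, hp, hpA⟩ := h
  induction p generalizing a with
  | nil => cases hp; exact hr _
  | cons d p ih =>
    obtain ⟨rfl, hp⟩ := hp
    exact ht _ _ _ (hA d (hpA d (by simp))) (ih hp fun e he => hpA e (by simp [he]))

theorem ReachableIn.symm {A : Set D} {rev : D → D} (hA : ∀ d ∈ A, rev d ∈ A)
    (hsrc : ∀ d, src (rev d) = tgt d) (htgt : ∀ d, tgt (rev d) = src d) {a b : N}
    (h : ReachableIn src tgt A a b) : ReachableIn src tgt A b a := by
  refine h.lift (r := fun a b => ReachableIn src tgt A b a) (ReachableIn.refl A)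
    (fun _ _ _ h₁ h₂ => h₂.trans h₁) fun d hd => ?_
  simpa only [hsrc, htgt] using ReachableIn.of_mem (src := src) (tgt := tgt) (hA d hd)

/-- A connected multigraph with `n` nodes has at least `n - 1` edges. -/
theorem two_mul_card_le_ncard_add_two [Finite D] [Finite N] {A : Set D} {rev : D → D}
    (hA : ∀ d ∈ A, rev d ∈ A) (hsrc : ∀ d, src (rev d) = tgt d) (htgt : ∀ d, tgt (rev d) = src d)
    (hconn : ∀ a b, ReachableIn src tgt A a b) : 2 * Nat.card N ≤ A.ncard + 2 := by
  classical
  cases isEmpty_or_nonempty N with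
  | inl h => simp
  | inr h =>
    have := Fintype.ofFinite N
    -- Discarding loops and merging parallel edges keeps connectivity and can only lower the edge
    -- count.
    let H : SimpleGraph N :=
      { Adj := fun a b => a ≠ b ∧ ∃ d ∈ A, src d = a ∧ tgt d = b
        symm := ⟨by
          rintro a b ⟨hab, d, hd, rfl, rfl⟩
          exact ⟨hab.symm, rev d, hA d hd, hsrc d, htgt d⟩⟩
        loopless := ⟨fun a h => h.1 rfl⟩ }
    have hH : H.Connected :=
      { preconnected := fun a b => (hconn a b).lift (r := H.Reachable)
          (fun a => SimpleGraph.Reachable.refl a) (fun _ _ _ h₁ h₂ => h₁.trans h₂) (by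
            intro d hd
            by_cases hab : src d = tgt d
            · rw [hab]
            · exact SimpleGraph.Adj.reachable (G := H) ⟨hab, d, hd, rfl, rfl⟩)
        nonempty := h }
    have h₁ := hH.card_vert_le_card_edgeSet_add_one
    choose g hgA hgs hgt using fun x : H.Dart => (show H.Adj x.fst x.snd from x.adj).2
    have h₂ : Nat.card H.Dart ≤ Nat.card A := by
      refine Nat.card_le_card_of_injective (fun x => (⟨g x, hgA x⟩ : A)) fun x y hxy => ?_
      have hxy : g x = g y := congrArg Subtype.val hxy
      refine SimpleGraph.Dart.ext _ _ (Prod.ext ?_ ?_)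
      · exact (hgs x).symm.trans ((congrArg src hxy).trans (hgs y))
      · exact (hgt x).symm.trans ((congrArg tgt hxy).trans (hgt y))
    rw [Nat.card_eq_fintype_card, H.dart_card_eq_twice_card_edges, Nat.card_coe_set_eq] at h₂
    rw [Nat.card_eq_fintype_card (α := H.edgeSet), ← SimpleGraph.edgeFinset_card] at h₁
    omega

end Walks

/-! ### Incidence of darts, vertices and faces -/

namespace EmbeddedGraph

section

variable {D : Type*} (G : EmbeddedGraph D)

theorem head_rev (d : D) : G.head (G.rev d) = G.tail d := by
  rw [head, G.rev_rev]

theorem rightFace_rev (d : D) : G.rightFace (G.rev d) = G.leftFace d := by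
  rw [rightFace, G.rev_rev]

/-- `faceNext` takes `G.rev d` to `G.rot.symm d`. This lets faces be followed while turning around a
vertex. -/
theorem leftFace_rot_symm (d : D) : G.leftFace (G.rot.symm d) = G.rightFace d := by
  refine Quotient.sound (s := Equiv.Perm.SameCycle.setoid G.faceNext)
    (Equiv.Perm.SameCycle.symm ⟨1, ?_⟩)
  simp only [faceNext, zpow_one, Equiv.trans_apply, EmbeddingLike.apply_eq_iff_eq]
  exact G.rev_rev d

theorem tail_rot (d : D) : G.tail (G.rot d) = G.tail d :=
  Quotient.sound (s := Equiv.Perm.SameCycle.setoid G.rot)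
    (Equiv.Perm.SameCycle.symm ⟨1, by simp⟩)

theorem tail_surjective : Function.Surjective G.tail := Quotient.mk_surjective

theorem leftFace_surjective : Function.Surjective G.leftFace := Quotient.mk_surjective

variable {G}

/-! ### Face boundaries and tree-cotree duality -/

/-- A non-empty finite set of edges without a vertex of degree one contains a simple cycle. -/
theorem exists_isSimpleCycle [Finite D] {B : Set D} {next : D → D} (hB : ∀ d ∈ B, next d ∈ B)
    (hrev : ∀ d ∈ B, next d ≠ G.rev d) (htail : ∀ d ∈ B, G.tail (next d) = G.head d)
    (hne : B.Nonempty) : ∃ C, G.IsSimpleCycle C ∧ ∀ d ∈ C, d ∈ B := by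
  classical
  obtain ⟨d₀, hd₀⟩ := hne
  have hmem : ∀ n, next^[n] d₀ ∈ B := by
    intro n
    induction n with
    | zero => exact hd₀
    | succ n ih => rw [Function.iterate_succ_apply']; exact hB _ ih
  obtain ⟨x, hx⟩ : ∃ x : ℕ → D, x = fun n => next^[n] d₀ := ⟨_, rfl⟩
  have hxB : ∀ n, x n ∈ B := fun n => by rw [hx]; exact hmem n
  have hxs : ∀ n, x (n + 1) = next (x n) := fun n => by
    simp only [hx, Function.iterate_succ_apply']
  have hhead : ∀ n, G.head (x n) = G.tail (x (n + 1)) := fun n => by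
    rw [hxs, htail _ (hxB n)]
  have hxr : ∀ n, x (n + 1) ≠ G.rev (x n) := fun n => by rw [hxs]; exact hrev _ (hxB n)
  -- The cycle is the segment of the non-backtracking walk `x` up to the first repeated tail.
  have hrep : ∃ j, ∃ i < j, G.tail (x i) = G.tail (x j) := by
    obtain ⟨i, j, hij, h⟩ := Finite.exists_ne_map_eq_of_infinite x
    rcases lt_or_gt_of_ne hij with h' | h'
    · exact ⟨j, i, h', by rw [h]⟩
    · exact ⟨i, j, h', by rw [h]⟩
  obtain ⟨i, hij, htij⟩ := Nat.find_spec hrep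
  have hmin : ∀ a b, a < b → b < Nat.find hrep → G.tail (x a) ≠ G.tail (x b) :=
    fun a b hab hb h => Nat.find_min hrep hb ⟨a, hab, h⟩
  generalize Nat.find hrep = j at hij htij hmin
  have hinj : ∀ a b, a < j → b < j → G.tail (x a) = G.tail (x b) → a = b := by
    intro a b ha hb h
    rcases lt_trichotomy a b with h' | h' | h'
    · exact absurd h (hmin a b h' hb)
    · exact h'
    · exact absurd h.symm (hmin b a h' ha)
  have hwalk : ∀ m k, IsWalk G.tail G.head (G.tail (x m)) ((List.range' m k).map x)
      (G.tail (x (m + k))) := by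
    intro m k
    induction k generalizing m with
    | zero => exact rfl
    | succ k ih =>
      refine ⟨rfl, ?_⟩
      have := ih (m + 1)
      rw [← hhead, show m + 1 + k = m + (k + 1) by omega] at this
      exact this
  refine ⟨(List.range' i (j - i)).map x, ⟨?_, ⟨G.tail (x i), ?_⟩, ?_, ?_⟩, ?_⟩
  · simp; omega
  · have := hwalk i (j - i)
    rwa [Nat.add_sub_cancel' hij.le, ← htij] at this
  · rw [List.map_map]
    refine List.Nodup.map_on ?_ List.nodup_range'
    intro a ha b hb h
    simp only [List.mem_range'_1] at ha hb
    exact hinj a b (by omega) (by omega) h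
  · intro d hd hd'
    obtain ⟨a, ha, rfl⟩ := List.mem_map.1 hd
    obtain ⟨b, hb, hab⟩ := List.mem_map.1 hd'
    simp only [List.mem_range'_1] at ha hb
    -- Since `x` never backtracks, a reversed pair must consist of the last and the first dart. By
    -- symmetry the two indices then coincide.
    have key : ∀ a b, i ≤ a → a < j → i ≤ b → b < j → x b = G.rev (x a) →
        a + 1 = j ∧ b = i := by
      intro a b hia haj hib hbj hab
      have h : G.tail (x b) = G.tail (x (a + 1)) := by rw [hab, ← hhead]; rfl
      rcases Nat.lt_or_ge (a + 1) j with h' | h'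
      · exact absurd (hinj _ _ hbj h' h ▸ hab) (hxr a)
      · obtain rfl : a + 1 = j := by omega
        exact ⟨rfl, hinj _ _ hbj hij (h.trans htij.symm)⟩
    have h₁ := key a b ha.1 (by omega) hb.1 (by omega) hab
    have h₂ := key b a hb.1 (by omega) ha.1 (by omega) (by rw [hab, G.rev_rev])
    obtain rfl : a = b := by omega
    exact G.rev_ne _ hab.symm
  · intro d hd
    obtain ⟨a, -, rfl⟩ := List.mem_map.1 hd
    exact hxB a

/-- The boundary of a set of faces has no vertex of degree one. -/
theorem exists_ne_of_mem_boundary [Finite D] (S : Set G.Face) {d : D}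
    (hd : ¬(G.leftFace d ∈ S ↔ G.rightFace d ∈ S)) :
    ∃ e, e ≠ d ∧ G.tail e = G.tail d ∧ ¬(G.leftFace e ∈ S ↔ G.rightFace e ∈ S) := by
  by_contra! h
  -- If `d` were the only boundary dart at its tail, membership in `S` would stay constant all the
  -- way round to `G.rot.symm d`, whose left face is the right face of `d`.
  have hpow : ∀ n : ℕ, G.tail ((G.rot ^ n) d) = G.tail d ∧
      (G.leftFace ((G.rot ^ n) d) ∈ S ↔ G.leftFace d ∈ S) := by
    intro n
    induction n with
    | zero => simp
    | succ n ih =>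
      rw [pow_succ', Equiv.Perm.mul_apply]
      have ht : G.tail (G.rot ((G.rot ^ n) d)) = G.tail d := (G.tail_rot _).trans ih.1
      refine ⟨ht, ?_⟩
      by_cases he : G.rot ((G.rot ^ n) d) = d
      · rw [he]
      · rw [h _ he ht, ← leftFace_rot_symm, Equiv.symm_apply_apply, ih.2]
  obtain ⟨n, hn⟩ : ∃ n : ℕ, G.rot ^ n = G.rot⁻¹ :=
    (isOfFinOrder_of_finite G.rot).mem_powers_iff_mem_zpowers.2 ⟨-1, by simp⟩
  have := (hpow n).2
  rw [hn] at this
  change G.leftFace (G.rot.symm d) ∈ S ↔ _ at this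
  rw [leftFace_rot_symm] at this
  exact hd this.symm

/-- In a connected graph, every proper non-empty set of faces has a boundary. -/
theorem exists_mem_boundary (hconn : ∀ u v : G.Vertex, ∃ p, IsWalk G.tail G.head u p v)
    {S : Set G.Face} {a b : G.Face} (ha : a ∈ S) (hb : b ∉ S) :
    ∃ d, ¬(G.leftFace d ∈ S ↔ G.rightFace d ∈ S) := by
  by_contra! h
  have hrot : ∀ d, G.leftFace (G.rot d) ∈ S ↔ G.leftFace d ∈ S := fun d => by
    rw [h, ← leftFace_rot_symm, Equiv.symm_apply_apply]
  have hvert : ∀ d e, G.tail d = G.tail e → (G.leftFace d ∈ S ↔ G.leftFace e ∈ S) := by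
    intro d e hde
    obtain ⟨k, rfl⟩ : G.rot.SameCycle d e := Quotient.exact hde
    clear hde
    induction k using Int.induction_on with
    | zero => simp
    | succ k ih =>
      rw [add_comm, zpow_add, zpow_one, Equiv.Perm.mul_apply, hrot, ih]
    | pred k ih =>
      rw [ih, ← hrot ((G.rot ^ (-(k : ℤ) - 1)) d), ← Equiv.Perm.mul_apply, ← zpow_one_add,
        add_sub_cancel]
  have hreach : ∀ u v : G.Vertex, ∀ d e, G.tail d = u → G.tail e = v →
      (G.leftFace d ∈ S ↔ G.leftFace e ∈ S) := by
    intro u v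
    obtain ⟨p, hp⟩ := hconn u v
    have hr : ReachableIn G.tail G.head Set.univ u v := ⟨p, hp, fun _ _ => trivial⟩
    refine hr.lift (r := fun u v => ∀ d e, G.tail d = u → G.tail e = v →
      (G.leftFace d ∈ S ↔ G.leftFace e ∈ S)) ?_ ?_ ?_
    · exact fun u d e hd he => hvert d e (hd.trans he.symm)
    · intro u v t h₁ h₂ d e hd he
      obtain ⟨c, hc⟩ := G.tail_surjective v
      exact (h₁ d c hd hc).trans (h₂ c e hc he)
    · intro c _ d e hd he
      exact (hvert d c hd).trans ((h c).trans (hvert (G.rev c) e he.symm))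
  obtain ⟨d, rfl⟩ := G.leftFace_surjective a
  obtain ⟨e, rfl⟩ := G.leftFace_surjective b
  exact hb ((hreach _ _ d e rfl rfl).1 ha)

/-- The edges outside a spanning tree connect the dual. -/
theorem IsSpanningTree.reachableIn_compl [Finite D]
    (hconn : ∀ u v : G.Vertex, ∃ p, IsWalk G.tail G.head u p v) {T : Set D}
    (hT : G.IsSpanningTree T) (a b : G.Face) :
    ReachableIn G.leftFace G.rightFace Tᶜ a b := by
  by_contra hab
  set S : Set G.Face := {c | ReachableIn G.leftFace G.rightFace Tᶜ a c} with hS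
  set B : Set D := {d | ¬(G.leftFace d ∈ S ↔ G.rightFace d ∈ S)} with hB
  have hne : B.Nonempty := exists_mem_boundary hconn (S := S) (ReachableIn.refl _ a) hab
  have hrevB : ∀ d ∈ B, G.rev d ∈ B := by
    intro d hd h
    rw [rightFace_rev] at h
    exact hd h.symm
  have hBT : ∀ d ∈ B, d ∈ T := by
    intro d hd
    by_contra hdT
    have hdT' : G.rev d ∈ Tᶜ := fun h => hdT (G.rev_rev d ▸ hT.1 _ h)
    refine hd ⟨fun h => h.trans (.of_mem hdT), fun h => h.trans ?_⟩
    have := ReachableIn.of_mem (src := G.leftFace) (tgt := G.rightFace) hdT'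
    rwa [rightFace_rev] at this
  have hnext : ∀ d, ∃ e, d ∈ B → e ≠ G.rev d ∧ G.tail e = G.head d ∧ e ∈ B := by
    intro d
    by_cases hd : d ∈ B
    · obtain ⟨e, he⟩ := exists_ne_of_mem_boundary S (hrevB d hd)
      exact ⟨e, fun _ => he⟩
    -- Outside `B` the successor is a junk value.
    · exact ⟨d, fun h => absurd h hd⟩
  choose next hnext using hnext
  obtain ⟨C, hC, hCB⟩ := exists_isSimpleCycle (G := G) (fun d hd => (hnext d hd).2.2)
    (fun d hd => (hnext d hd).1) (fun d hd => (hnext d hd).2.1) hne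
  obtain ⟨d, hdC, hdT⟩ := hT.2.2 C hC
  exact hdT (hBT d (hCB d hdC))

/-- In a plane graph, the dual edges outside a spanning tree are bridges of their union. -/
theorem IsSpanningTree.not_reachableIn_diff [Finite D] (hG : G.IsPlane) {T : Set D}
    (hT : G.IsSpanningTree T) {d : D} (hd : d ∉ T) :
    ¬ReachableIn G.leftFace G.rightFace (Tᶜ \ {d, G.rev d}) (G.leftFace d) (G.rightFace d) := by
  intro h
  have hrevT : ∀ e, e ∉ T → G.rev e ∉ T := fun e he h => he (G.rev_rev e ▸ hT.1 _ h)
  have hA : ∀ e ∈ Tᶜ \ {d, G.rev d}, G.rev e ∈ Tᶜ \ {d, G.rev d} := by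
    rintro e ⟨he, hed⟩
    refine ⟨hrevT e he, fun h => hed ?_⟩
    rcases h with h | h
    · exact Or.inr (by rw [Set.mem_singleton_iff, ← h, G.rev_rev])
    · exact Or.inl (by rw [← G.rev_rev e, Set.mem_singleton_iff.1 h, G.rev_rev])
  have hconn : ∀ a b, ReachableIn G.leftFace G.rightFace (Tᶜ \ {d, G.rev d}) a b := by
    intro a b
    refine (hT.reachableIn_compl hG.1 a b).lift (ReachableIn.refl _)
      (fun _ _ _ h₁ h₂ => h₁.trans h₂) fun e he => ?_
    by_cases hed : e ∈ ({d, G.rev d} : Set D)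
    · rcases hed with rfl | rfl
      · exact h
      · rw [rightFace_rev]
        exact h.symm hA (fun _ => rfl) G.rightFace_rev
    · exact .of_mem ⟨he, hed⟩
  have : Finite G.Vertex := Quotient.finite _
  have : Finite G.Face := Quotient.finite _
  -- The two edge counts give `2F ≤ |Tᶜ|` and `2V ≤ |T| + 2`, so `2(V + F) ≤ |D| + 2`, against
  -- Euler's `|D| + 4`.
  have h₁ := two_mul_card_le_ncard_add_two hA (fun _ => rfl) G.rightFace_rev hconn
  have h₂ := two_mul_card_le_ncard_add_two hT.1 (fun _ => rfl) G.head_rev hT.2.1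
  have h₃ : ({d, G.rev d} : Set D) ⊆ Tᶜ := by
    rintro e (rfl | rfl)
    exacts [hd, hrevT _ hd]
  have h₄ := Set.ncard_sdiff_add_ncard_of_subset h₃
  rw [Set.ncard_pair (G.rev_ne d).symm] at h₄
  have h₅ := Set.ncard_add_ncard_compl T
  have h₆ := hG.2
  omega

/-! ### Rootwise orientation and root paths -/

/-- Otherwise both faces of `d` would reach the root without crossing its edge, which is a bridge of
the dual tree. -/
theorem rev_notMem_treeOrientation [Finite D] (hG : G.IsPlane) {T : Set D}
    (hT : G.IsSpanningTree T) {r : G.Face} {d : D} (hd : d ∈ G.treeOrientation T r) :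
    G.rev d ∉ G.treeOrientation T r := by
  have avoid : ∀ e ∈ G.treeOrientation T r, ReachableIn G.leftFace G.rightFace
      (Tᶜ \ {e, G.rev e}) (G.rightFace e) r := by
    rintro e ⟨p, ⟨⟨-, hp⟩, hn⟩, hpT⟩
    have hn := (List.nodup_cons.1 hn).1
    refine ⟨p, hp, fun c hc => ⟨hpT c (by simp [hc]), ?_⟩⟩
    -- Using either dart of the edge again would revisit the left face of `e`, where the path
    -- starts.
    rintro (rfl | rfl)
    · exact hn (hp.src_mem hc)
    · exact hn (List.mem_cons_of_mem _ (List.mem_map.2 ⟨_, hc, G.rightFace_rev e⟩))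
  intro hd'
  have h₁ := avoid d hd
  have h₂ := avoid _ hd'
  rw [rightFace_rev, G.rev_rev, Set.pair_comm] at h₂
  have hdT : d ∉ T := hd.choose_spec.2 d (by simp)
  refine hT.not_reachableIn_diff hG hdT (h₂.trans (h₁.symm (rev := G.rev) ?_ (fun _ => rfl)
    G.rightFace_rev))
  rintro e ⟨he, hed⟩
  refine ⟨fun h => he (G.rev_rev e ▸ hT.1 _ h), fun h => hed ?_⟩
  rcases h with h | h
  · exact Or.inr (by rw [Set.mem_singleton_iff, ← h, G.rev_rev])
  · exact Or.inl (by rw [← G.rev_rev e, Set.mem_singleton_iff.1 h, G.rev_rev])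

theorem IsRootPath.of_cons {T : Set D} {r a : G.Face} {d : D} {p : List D}
    (h : G.IsRootPath T r a (d :: p)) : G.IsRootPath T r (G.rightFace d) p :=
  ⟨⟨h.1.1.2, (List.nodup_cons.1 h.1.2).2⟩, fun e he => h.2 e (by simp [he])⟩

theorem IsRootPath.mem_treeOrientation {T : Set D} {r a : G.Face} {p : List D}
    (h : G.IsRootPath T r a p) {d : D} (hd : d ∈ p) : d ∈ G.treeOrientation T r := by
  induction p generalizing a with
  | nil => simp at hd
  | cons e p ih =>
    rcases List.mem_cons.1 hd with rfl | hd
    · exact ⟨p, by rw [h.1.1.1]; exact h⟩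
    · exact ih h.of_cons hd

theorem IsSpanningTree.exists_isRootPath [Finite D] (hG : G.IsPlane) {T : Set D}
    (hT : G.IsSpanningTree T) (r a : G.Face) : ∃ p, G.IsRootPath T r a p := by
  obtain ⟨p, hp, hpT⟩ := hT.reachableIn_compl hG.1 a r
  obtain ⟨q, hqp, hq⟩ := hp.exists_isPath
  exact ⟨q, hq, fun d hd => hpT d (hqp hd)⟩

/-! ### Crossings of root paths with the cycle -/

/-- Crossing an edge that is not on `C` does not change whether a face is enclosed. -/
theorem Encloses.of_rightFace {infty : G.Face} {C : List D} {d : D} (hd : d ∉ C)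
    (hd' : G.rev d ∉ C) (h : G.Encloses infty C (G.rightFace d)) :
    G.Encloses infty C (G.leftFace d) := by
  intro p hp
  obtain ⟨e, he, heC⟩ := h (G.rev d :: p) ⟨rfl, by rwa [rightFace_rev]⟩
  rcases List.mem_cons.1 he with rfl | he
  · rw [G.rev_rev] at heC
    exact (heC.elim hd' hd).elim
  · exact ⟨e, he, heC⟩

/-- If an oriented cycle has its interior to its left and no root path runs against it, then root
paths enter the cycle nowhere. -/
theorem encloses_of_mem_isRootPath {infty r : G.Face} {T : Set D} {C : List D}
    (hccw : G.IsCounterclockwise infty C) {a : G.Face} {p : List D}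
    (hp : G.IsRootPath T r a p) (hrev : ∀ d ∈ p, G.rev d ∉ C) {d : D} (hd : d ∈ p)
    (hdC : d ∈ C) : G.Encloses infty C a := by
  induction p generalizing a with
  | nil => simp at hd
  | cons e p ih =>
    obtain rfl : G.leftFace e = a := hp.1.1.1
    by_cases he : e ∈ C
    · exact hccw e he
    · refine Encloses.of_rightFace he (hrev e (by simp)) ?_
      refine ih hp.of_cons (fun c hc => hrev c (by simp [hc])) ?_
      rcases List.mem_cons.1 hd with rfl | hd
      · exact absurd hdC he
      · exact hd

/-- The tree orientation never runs against a cycle that agrees with it. -/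
theorem AgreesWithTree.rev_notMem [Finite D] (hG : G.IsPlane) {T : Set D}
    (hT : G.IsSpanningTree T) {r : G.Face} {C : List D} (hC : G.AgreesWithTree T r C) {d : D}
    (hd : d ∈ G.treeOrientation T r) : G.rev d ∉ C := by
  intro h
  have hdT : d ∉ T := hd.choose_spec.2 d (by simp)
  exact rev_notMem_treeOrientation hG hT hd
    (hC _ h fun h' => hdT (G.rev_rev d ▸ hT.1 _ h'))

end

end EmbeddedGraph

theorem mainTheorem8 {D : Type*} [Finite D] (G : EmbeddedGraph D) (hG : G.IsPlane)
    (w : D → ENNReal) (hw : ∀ d, w (G.rev d) = w d)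
    (vInt vExt : G.Face) (X : Set G.Face)
    (f : G.Vertex) (T : Set D) (hT : G.IsShortestPathTree w f T)
    (C : List D) (hC : G.IsSimpleCycle C) (hccw : G.IsCounterclockwise vExt C)
    (hsep : G.Separates C vInt vExt) (hf : f ∈ C.map G.tail)
    (hagree : G.AgreesWithTree T vExt C) :
    (∃ t ∈ X, G.Encloses vExt C t) ↔ ∃ d ∈ C, d ∈ G.redDarts T vExt X := by
  have hTree := hT.1
  constructor
  · rintro ⟨t, htX, ht⟩
    obtain ⟨p, hp⟩ := hTree.exists_isRootPath hG vExt t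
    obtain ⟨d, hdp, hd⟩ := ht p hp.1.1
    have hdO := hp.mem_treeOrientation hdp
    exact ⟨d, hd.resolve_right (hagree.rev_notMem hG hTree hdO), hdO, t, htX, p, hp, Or.inl hdp⟩
  · rintro ⟨d, hdC, hdO, t, htX, p, hp, hd⟩
    -- An ancestor edge is traversed rootwards, hence along its red dart and not against it.
    have hdp : d ∈ p := hd.resolve_right fun h =>
      EmbeddedGraph.rev_notMem_treeOrientation hG hTree hdO (hp.mem_treeOrientation h)
    exact ⟨t, htX, EmbeddedGraph.encloses_of_mem_isRootPath hccw hp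
      (fun e he => hagree.rev_notMem hG hTree (hp.mem_treeOrientation he)) hdp hdC⟩
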